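/- Let $n\ge 1$ and $N\ge 1$ be integers, let $\mathcal X\subset\mathbb R^n$ be a convex body, i.e. a convex compact set with non-empty interior, and let $c\in\mathbb R^n$. Put $$f^*=\min_{x\in\mathcal X}c^Tx,\qquad h=\max_{x\in\mathcal X}c^Tx-\min_{x\in\mathcal X}c^Tx .$$ Let $x^{(1)},\dots,x^{(N)}$ be independent random points, each uniformly distributed on $\mathcal X$, and let $f_{[1]}=\min_{i=1,\dots,N}c^Tx^{(i)}$ be the empirical minimum. Then $(f_{[1]}-f^*)^2$ is integrable and $$\mathbb E\big[(f_{[1]}-f^*)^2\big]\le\frac{2h^2}{n}\,B\!\left(N+1,\frac2n\right),$$ where $B(a,b)=\int_0^1 t^{a-1}(1-t)^{b-1}\,dt=\Gamma(a)\Gamma(b)/\Gamma(a+b)$ is the Euler Beta function. If moreover $n\ge 2$, then $$\frac{2h^2}{n}\,B\!\left(N+1,\frac2n\right)\le h^2\left(\frac1{N+1}\right)^{\frac2n}.$$ -/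

import Mathlib

open MeasureTheory ProbabilityTheory

/-- `f^* = min_{x ∈ X} cᵀx`. -/
noncomputable def linMin {n : ℕ} (c : EuclideanSpace ℝ (Fin n))
    (X : Set (EuclideanSpace ℝ (Fin n))) : ℝ :=
  sInf ((fun x => inner ℝ c x) '' X)

/-- `max_{x ∈ X} cᵀx`. -/
noncomputable def linMax {n : ℕ} (c : EuclideanSpace ℝ (Fin n))
    (X : Set (EuclideanSpace ℝ (Fin n))) : ℝ :=
  sSup ((fun x => inner ℝ c x) '' X)

/-- `h = max_{x ∈ X} cᵀx - min_{x ∈ X} cᵀx`. -/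
noncomputable def linWidth {n : ℕ} (c : EuclideanSpace ℝ (Fin n))
    (X : Set (EuclideanSpace ℝ (Fin n))) : ℝ :=
  linMax c X - linMin c X

/-- The empirical minimum `f_[1] = min_{i = 1, …, N} cᵀx⁽ⁱ⁾` of `N ≥ 1` random points. -/
noncomputable def empiricalMin {n N : ℕ} {Ω : Type*} (c : EuclideanSpace ℝ (Fin n))
    (x : Fin N → Ω → EuclideanSpace ℝ (Fin n)) (ω : Ω) : ℝ :=
  ⨅ i, inner ℝ c (x i ω)

/-- A convex body: a convex compact set with non-empty interior. -/
structure IsConvexBody {n : ℕ} (X : Set (EuclideanSpace ℝ (Fin n))) : Prop where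
  convex : Convex ℝ X
  isCompact : IsCompact X
  interior_nonempty : (interior X).Nonempty

/-- On a convex body the infimum is attained: `linMin` is a minimum. -/
theorem IsConvexBody.isLeast_linMin {n : ℕ} {X : Set (EuclideanSpace ℝ (Fin n))}
    (hX : IsConvexBody X) (c : EuclideanSpace ℝ (Fin n)) :
    IsLeast ((fun x => inner ℝ c x) '' X) (linMin c X) :=
  (hX.isCompact.image (by fun_prop)).isLeast_sInf
    ((hX.interior_nonempty.mono interior_subset).image _)

/-- On a convex body the supremum is attained: `linMax` is a maximum. -/
theorem IsConvexBody.isGreatest_linMax {n : ℕ} {X : Set (EuclideanSpace ℝ (Fin n))}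
    (hX : IsConvexBody X) (c : EuclideanSpace ℝ (Fin n)) :
    IsGreatest ((fun x => inner ℝ c x) '' X) (linMax c X) :=
  (hX.isCompact.image (by fun_prop)).isGreatest_sSup
    ((hX.interior_nonempty.mono interior_subset).image _)

/-! Shrinking `X` by a factor `t` towards a minimizer keeps it inside `X` and at height at most `t
h`, so a uniform point exceeds that height with probability at most `1 - t ^ n`
(`IsConvexBody.volume_cap_le`). By independence the normalized gap `Z` satisfies `P(Z > t) ≤ (1 - t
^ n) ^ N`. With `p = 2 / n`, the layer-cake formula applied to `Z ^ 2 = (Z ^ n) ^ p` bounds the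
second moment by `p ∫₀¹ s ^ (p - 1) (1 - s) ^ N ds`, a Beta integral (`lintegral_sq_le_beta`). The
power bound is an estimate of Gamma ratios, valid for `p ≤ 1`, that is `n ≥ 2`. -/

theorem beta_comm (a b : ℝ) : beta a b = beta b a := by
  unfold beta; rw [mul_comm, add_comm]

/-- The ratio `Γ(1 + a) N! / Γ(N + 1 + a)` is at most `(N + 1) ^ (-a)` for `0 ≤ a ≤ 1`. -/
theorem Gamma_mul_div_le_rpow {a : ℝ} (ha : 0 < a) (ha1 : a ≤ 1) (N : ℕ) :
    Real.Gamma (1 + a) * Real.Gamma ((N : ℝ) + 1) / Real.Gamma ((N : ℝ) + 1 + a)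
      ≤ (1 / ((N : ℝ) + 1)) ^ a := by
  induction N with
  | zero => simp [(Real.Gamma_pos_of_pos (show 0 < 1 + a by linarith)).ne']
  | succ k ih =>
    have hk : (0 : ℝ) < (k : ℝ) + 1 := by positivity
    have hG := Real.Gamma_pos_of_pos (show 0 < (k : ℝ) + 1 + a by positivity)
    have e1 : Real.Gamma (((k + 1 : ℕ) : ℝ) + 1)
        = ((k : ℝ) + 1) * Real.Gamma ((k : ℝ) + 1) := by
      push_cast; exact Real.Gamma_add_one hk.ne'
    have e2 : Real.Gamma (((k + 1 : ℕ) : ℝ) + 1 + a)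
        = ((k : ℝ) + 1 + a) * Real.Gamma ((k : ℝ) + 1 + a) := by
      rw [← Real.Gamma_add_one (by positivity)]; push_cast; ring_nf
    -- Bernoulli for exponents in `[0, 1]`; its right side is exactly the inverse of the factor `(k
    -- + 1) / (k + 1 + a)` gained by the Gamma ratio.
    have hb : (1 + 1 / ((k : ℝ) + 1)) ^ a ≤ 1 + a * (1 / ((k : ℝ) + 1)) :=
      rpow_one_add_le_one_add_mul_self
        (by have : 0 < 1 / ((k : ℝ) + 1) := by positivity
            linarith) ha.le ha1
    have e3 : 1 / ((k : ℝ) + 1)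
        = (1 + 1 / ((k : ℝ) + 1)) * (1 / (((k + 1 : ℕ) : ℝ) + 1)) := by
      push_cast; field_simp
    rw [e3, Real.mul_rpow (by positivity) (by positivity)] at ih
    set r : ℝ := (1 / (((k + 1 : ℕ) : ℝ) + 1)) ^ a
    have hr : 0 ≤ r := by positivity
    rw [e1, e2]
    calc Real.Gamma (1 + a) * (((k : ℝ) + 1) * Real.Gamma ((k : ℝ) + 1))
          / (((k : ℝ) + 1 + a) * Real.Gamma ((k : ℝ) + 1 + a))
        = (((k : ℝ) + 1) / ((k : ℝ) + 1 + a)) * (Real.Gamma (1 + a)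
          * Real.Gamma ((k : ℝ) + 1) / Real.Gamma ((k : ℝ) + 1 + a)) := by
          field_simp
      _ ≤ (((k : ℝ) + 1) / ((k : ℝ) + 1 + a)) * ((1 + a * (1 / ((k : ℝ) + 1))) * r) := by
          refine mul_le_mul_of_nonneg_left (ih.trans ?_) (by positivity)
          exact mul_le_mul_of_nonneg_right hb hr
      _ = r := by field_simp

theorem mul_beta_le_rpow {a : ℝ} (ha : 0 < a) (ha1 : a ≤ 1) (N : ℕ) :
    a * beta ((N : ℝ) + 1) a ≤ (1 / ((N : ℝ) + 1)) ^ a := by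
  refine le_trans (le_of_eq ?_) (Gamma_mul_div_le_rpow ha ha1 N)
  rw [beta, add_comm 1 a, Real.Gamma_add_one ha.ne']
  ring

/-- Second moment of a nonnegative variable whose tail is at most `(1 - t ^ n) ^ N`. -/
theorem lintegral_sq_le_beta {n N : ℕ} (hn : 1 ≤ n) (hN : 1 ≤ N) {Ω : Type*}
    [MeasurableSpace Ω] {μ : Measure Ω} {Z : Ω → ℝ} (hZ : AEMeasurable Z μ)
    (hZ0 : 0 ≤ᵐ[μ] Z)
    (htail : ∀ t : ℝ, 0 ≤ t → t ≤ 1 → μ {ω | t < Z ω} ≤ ENNReal.ofReal ((1 - t ^ n) ^ N)) :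
    ∫⁻ ω, ENNReal.ofReal (Z ω ^ 2) ∂μ
      ≤ ENNReal.ofReal (2 / (n : ℝ) * beta ((N : ℝ) + 1) (2 / (n : ℝ))) := by
  have hn0 : (0 : ℝ) < n := by exact_mod_cast hn
  set p : ℝ := 2 / (n : ℝ) with hp
  have hp0 : 0 < p := by positivity
  have hN0 : (0 : ℝ) < (N : ℝ) + 1 := by positivity
  have hsq : ∀ᵐ ω ∂μ, ENNReal.ofReal (Z ω ^ 2) = ENNReal.ofReal ((Z ω ^ n) ^ p) := by
    filter_upwards [hZ0] with ω hω
    rw [← Real.rpow_natCast (Z ω) n, ← Real.rpow_mul hω, hp, mul_div_cancel₀ _ hn0.ne']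
    norm_num
  -- The layer-cake integrand is dominated by an unnormalized Beta density, whose total mass is
  -- known.
  have htailW : ∀ s : ℝ, 0 < s →
      μ {ω | s < Z ω ^ n} * ENNReal.ofReal (s ^ (p - 1))
        ≤ ENNReal.ofReal (beta p ((N : ℝ) + 1)) * betaPDF p ((N : ℝ) + 1) s := by
    intro s hs
    have hroot : (s ^ (1 / (n : ℝ))) ^ n = s := by
      rw [one_div, Real.rpow_inv_natCast_pow hs.le (by omega)]
    have hroot0 : 0 ≤ s ^ (1 / (n : ℝ)) := by positivity
    have hsub : ∀ t : ℝ, 0 ≤ t → t ^ n ≤ s → μ {ω | s < Z ω ^ n} ≤ μ {ω | t < Z ω} := by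
      intro t _ hts
      refine measure_mono_ae ?_
      filter_upwards [hZ0] with ω hω hlt
      exact lt_of_pow_lt_pow_left₀ n hω (hts.trans_lt hlt)
    rcases lt_or_ge s 1 with h1 | h1
    · have hle : s ^ (1 / (n : ℝ)) ≤ 1 := Real.rpow_le_one hs.le h1.le (by positivity)
      have h2 := (hsub _ hroot0 hroot.le).trans (htail _ hroot0 hle)
      rw [hroot] at h2
      rw [betaPDF_of_pos_lt_one hs h1, ← ENNReal.ofReal_mul (beta_pos hp0 hN0).le]
      refine (mul_le_mul_left h2 _).trans ?_
      rw [← ENNReal.ofReal_mul (pow_nonneg (by linarith) _)]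
      refine ENNReal.ofReal_le_ofReal (le_of_eq ?_)
      have := (beta_pos hp0 hN0).ne'
      rw [add_sub_cancel_right, Real.rpow_natCast]
      field_simp
    -- At `t = 1` the tail bound is `0 ^ N`, which vanishes because `N ≥ 1`.
    · have h2 := (hsub 1 zero_le_one (by simpa using h1)).trans (htail 1 zero_le_one le_rfl)
      have : μ {ω | s < Z ω ^ n} = 0 := by
        simpa [show N ≠ 0 by omega] using h2
      simp [this]
  rw [lintegral_congr_ae hsq,
    lintegral_rpow_eq_lintegral_meas_lt_mul μ (hZ0.mono fun ω hω => pow_nonneg hω n)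
      (hZ.pow_const n) hp0, ENNReal.ofReal_mul hp0.le, beta_comm]
  refine mul_le_mul_right ?_ _
  calc ∫⁻ s in Set.Ioi 0, μ {ω | s < Z ω ^ n} * ENNReal.ofReal (s ^ (p - 1))
      ≤ ∫⁻ s in Set.Ioi 0, ENNReal.ofReal (beta p ((N : ℝ) + 1)) * betaPDF p ((N : ℝ) + 1) s :=
        setLIntegral_mono' measurableSet_Ioi fun s hs => htailW s hs
    _ ≤ ∫⁻ s, ENNReal.ofReal (beta p ((N : ℝ) + 1)) * betaPDF p ((N : ℝ) + 1) s :=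
        setLIntegral_le_lintegral _ _
    _ = ENNReal.ofReal (beta p ((N : ℝ) + 1)) := by
        rw [lintegral_const_mul' _ _ ENNReal.ofReal_ne_top, lintegral_betaPDF_eq_one hp0 hN0,
          mul_one]

theorem empiricalMin_le {n N : ℕ} {Ω : Type*} {x : Fin N → Ω → EuclideanSpace ℝ (Fin n)}
    (c : EuclideanSpace ℝ (Fin n)) (ω : Ω) (i : Fin N) :
    empiricalMin c x ω ≤ inner ℝ c (x i ω) :=
  ciInf_le (Set.finite_range _).bddBelow i

section ConvexBody

variable {n : ℕ} {X : Set (EuclideanSpace ℝ (Fin n))}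

theorem IsConvexBody.volume_ne_zero (hX : IsConvexBody X) : volume X ≠ 0 :=
  (Measure.measure_pos_of_nonempty_interior _ hX.interior_nonempty).ne'

theorem IsConvexBody.volume_ne_top (hX : IsConvexBody X) : volume X ≠ ⊤ :=
  hX.isCompact.measure_lt_top.ne

theorem IsConvexBody.linMin_le (hX : IsConvexBody X) (c : EuclideanSpace ℝ (Fin n))
    {y : EuclideanSpace ℝ (Fin n)} (hy : y ∈ X) : linMin c X ≤ inner ℝ c y :=
  (hX.isLeast_linMin c).2 (Set.mem_image_of_mem _ hy)

theorem IsConvexBody.le_linMax (hX : IsConvexBody X) (c : EuclideanSpace ℝ (Fin n))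
    {y : EuclideanSpace ℝ (Fin n)} (hy : y ∈ X) : inner ℝ c y ≤ linMax c X :=
  (hX.isGreatest_linMax c).2 (Set.mem_image_of_mem _ hy)

theorem IsConvexBody.linWidth_nonneg (hX : IsConvexBody X) (c : EuclideanSpace ℝ (Fin n)) :
    0 ≤ linWidth c X := by
  obtain ⟨y, hy⟩ := hX.interior_nonempty
  have hy := interior_subset hy
  exact sub_nonneg.2 ((hX.linMin_le c hy).trans (hX.le_linMax c hy))

/-- The part of a convex body above height `t h` over its minimum fills at most the fraction
`1 - t ^ n` of the volume, because the body contains its homothetic copy of ratio `t` centred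
at a minimizer. -/
theorem IsConvexBody.volume_cap_le (hX : IsConvexBody X) (c : EuclideanSpace ℝ (Fin n))
    {t : ℝ} (ht0 : 0 ≤ t) (ht1 : t ≤ 1) :
    volume (X ∩ {y | t * linWidth c X < inner ℝ c y - linMin c X}) / volume X
      ≤ ENNReal.ofReal (1 - t ^ n) := by
  obtain ⟨x₀, hx₀, hx₀c⟩ := (hX.isLeast_linMin c).1
  simp only at hx₀c
  set A := {y : EuclideanSpace ℝ (Fin n) | t * linWidth c X < inner ℝ c y - linMin c X} with hA
  have hAm : MeasurableSet A := measurableSet_lt (by fun_prop) (by fun_prop)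
  have hsub : AffineMap.homothety x₀ t '' X ⊆ X \ A := by
    rintro _ ⟨y, hy, rfl⟩
    refine ⟨?_, ?_⟩
    · rw [AffineMap.homothety_eq_lineMap]
      exact hX.convex.lineMap_mem hx₀ hy ⟨ht0, ht1⟩
    · have h1 : inner ℝ c (AffineMap.homothety x₀ t y) - linMin c X
          = t * (inner ℝ c y - linMin c X) := by
        rw [AffineMap.homothety_apply, vsub_eq_sub, vadd_eq_add, inner_add_right,
          inner_smul_right, inner_sub_right, hx₀c]
        ring
      have h2 : t * (inner ℝ c y - linMin c X) ≤ t * linWidth c X :=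
        mul_le_mul_of_nonneg_left (sub_le_sub_right (hX.le_linMax c hy) _) ht0
      simpa [hA, h1] using h2
  have hvol : ENNReal.ofReal (t ^ n) * volume X ≤ volume (X \ A) := by
    refine le_trans (le_of_eq ?_) (measure_mono hsub)
    rw [Measure.addHaar_image_homothety, finrank_euclideanSpace_fin,
      abs_of_nonneg (pow_nonneg ht0 n)]
  have hadd := measure_inter_add_sdiff (μ := volume) X hAm
  refine ENNReal.div_le_of_le_mul ?_
  rw [ENNReal.ofReal_sub _ (pow_nonneg ht0 n), ENNReal.ofReal_one,
    ENNReal.sub_mul fun _ _ => hX.volume_ne_top, one_mul]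
  refine ENNReal.le_sub_of_add_le_right
    (ENNReal.mul_ne_top ENNReal.ofReal_ne_top hX.volume_ne_top) ?_
  exact (add_le_add_right hvol _).trans hadd.le

variable {N : ℕ} {Ω : Type*} [MeasurableSpace Ω] {μ : Measure Ω}
  {x : Fin N → Ω → EuclideanSpace ℝ (Fin n)}

theorem IsConvexBody.ae_mem (hX : IsConvexBody X)
    (hunif : ∀ i, pdf.IsUniform (x i) X μ volume) : ∀ᵐ ω ∂μ, ∀ i, x i ω ∈ X := by
  refine ae_all_iff.2 fun i => ?_
  have h := (hunif i).measure_preimage hX.volume_ne_zero hX.volume_ne_top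
    hX.isCompact.measurableSet.compl
  rw [Set.inter_compl_self, measure_empty, ENNReal.zero_div] at h
  exact h

theorem IsConvexBody.aemeasurable_empiricalMin (hX : IsConvexBody X)
    (hunif : ∀ i, pdf.IsUniform (x i) X μ volume) (c : EuclideanSpace ℝ (Fin n)) :
    AEMeasurable (empiricalMin c x) μ := by
  refine AEMeasurable.iInf fun i => ?_
  have := (hunif i).aemeasurable hX.volume_ne_zero hX.volume_ne_top
  fun_prop

/-- The minimum exceeds a level only if every sample point does, and these events are independent.
-/
theorem IsConvexBody.measure_empiricalMin_gt_le (hX : IsConvexBody X)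
    (hunif : ∀ i, pdf.IsUniform (x i) X μ volume) (hindep : iIndepFun x μ)
    (c : EuclideanSpace ℝ (Fin n)) {t : ℝ} (ht0 : 0 ≤ t) (ht1 : t ≤ 1) :
    μ {ω | t * linWidth c X < empiricalMin c x ω - linMin c X}
      ≤ ENNReal.ofReal ((1 - t ^ n) ^ N) := by
  set A := {y : EuclideanSpace ℝ (Fin n) | t * linWidth c X < inner ℝ c y - linMin c X}
  have hAm : MeasurableSet A := measurableSet_lt (by fun_prop) (by fun_prop)
  calc μ {ω | t * linWidth c X < empiricalMin c x ω - linMin c X}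
      ≤ μ (⋂ i ∈ (Finset.univ : Finset (Fin N)), x i ⁻¹' A) := by
        refine measure_mono fun ω hω => ?_
        simp only [Set.mem_iInter]
        intro i _
        exact lt_of_lt_of_le hω (sub_le_sub_right (empiricalMin_le c ω i) _)
    _ = ∏ i : Fin N, μ (x i ⁻¹' A) :=
        hindep.measure_inter_preimage_eq_mul _ fun _ _ => hAm
    _ ≤ ∏ _i : Fin N, ENNReal.ofReal (1 - t ^ n) := by
        refine Finset.prod_le_prod' fun i _ => ?_
        rw [(hunif i).measure_preimage hX.volume_ne_zero hX.volume_ne_top hAm]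
        exact hX.volume_cap_le c ht0 ht1
    _ = ENNReal.ofReal ((1 - t ^ n) ^ N) := by
        rw [Finset.prod_const, Finset.card_univ, Fintype.card_fin,
          ENNReal.ofReal_pow (sub_nonneg.2 (pow_le_one₀ ht0 ht1))]

theorem IsConvexBody.ae_empiricalMin_mem_Icc (hN : 1 ≤ N) (hX : IsConvexBody X)
    (hunif : ∀ i, pdf.IsUniform (x i) X μ volume) (c : EuclideanSpace ℝ (Fin n)) :
    ∀ᵐ ω ∂μ, empiricalMin c x ω - linMin c X ∈ Set.Icc 0 (linWidth c X) := by
  have : Nonempty (Fin N) := ⟨⟨0, hN⟩⟩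
  filter_upwards [hX.ae_mem hunif] with ω hω
  refine ⟨sub_nonneg.2 (le_ciInf fun i => hX.linMin_le c (hω i)), sub_le_sub_right ?_ _⟩
  exact (empiricalMin_le c ω ⟨0, hN⟩).trans (hX.le_linMax c (hω _))

end ConvexBody

theorem mainTheorem2 {n N : ℕ} (hn : 1 ≤ n) (hN : 1 ≤ N)
    (X : Set (EuclideanSpace ℝ (Fin n))) (hX : IsConvexBody X)
    (c : EuclideanSpace ℝ (Fin n))
    {Ω : Type*} [MeasurableSpace Ω] (μ : Measure Ω) [IsProbabilityMeasure μ]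
    (x : Fin N → Ω → EuclideanSpace ℝ (Fin n))
    (hunif : ∀ i, pdf.IsUniform (x i) X μ volume)
    (hindep : iIndepFun x μ) :
    Integrable (fun ω => (empiricalMin c x ω - linMin c X) ^ 2) μ ∧
    ∫ ω, (empiricalMin c x ω - linMin c X) ^ 2 ∂μ
      ≤ 2 * linWidth c X ^ 2 / (n : ℝ) * beta ((N : ℝ) + 1) (2 / (n : ℝ)) ∧
    (2 ≤ n →
      2 * linWidth c X ^ 2 / (n : ℝ) * beta ((N : ℝ) + 1) (2 / (n : ℝ))
        ≤ linWidth c X ^ 2 * (1 / ((N : ℝ) + 1)) ^ (2 / (n : ℝ))) := by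
  have hmem := hX.ae_empiricalMin_mem_Icc hN hunif c
  have hmeas : AEMeasurable (fun ω => empiricalMin c x ω - linMin c X) μ :=
    (hX.aemeasurable_empiricalMin hunif c).sub_const _
  have hn0 : (0 : ℝ) < n := by exact_mod_cast hn
  have hw := hX.linWidth_nonneg c
  refine ⟨?_, ?_, fun hn2 => ?_⟩
  · refine Integrable.of_bound (hmeas.pow_const 2).aestronglyMeasurable (linWidth c X ^ 2) ?_
    filter_upwards [hmem] with ω hω
    rw [Real.norm_of_nonneg (sq_nonneg _)]
    exact pow_le_pow_left₀ hω.1 hω.2 2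
  · set Z : Ω → ℝ := fun ω => (empiricalMin c x ω - linMin c X) / linWidth c X with hZ
    have hYZ : ∀ᵐ ω ∂μ, (empiricalMin c x ω - linMin c X) ^ 2 = linWidth c X ^ 2 * Z ω ^ 2 := by
      filter_upwards [hmem] with ω hω
      -- The width may vanish, for instance when `c = 0`; then `Z = 0` by division by zero and the
      -- gap is zero too.
      rcases hw.eq_or_lt with h0 | h0
      · rw [← h0] at hω ⊢
        simp [le_antisymm hω.2 hω.1]
      · simp only [hZ]
        field_simp
    have hlin : ∫⁻ ω, ENNReal.ofReal (Z ω ^ 2) ∂μ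
        ≤ ENNReal.ofReal (2 / (n : ℝ) * beta ((N : ℝ) + 1) (2 / (n : ℝ))) := by
      refine lintegral_sq_le_beta hn hN (hmeas.div_const _) ?_ fun t ht0 ht1 => ?_
      · filter_upwards [hmem] with ω hω
        exact div_nonneg hω.1 hw
      · refine le_trans (measure_mono fun ω hω => ?_)
          (hX.measure_empiricalMin_gt_le hunif hindep c ht0 ht1)
        have hω' : t < (empiricalMin c x ω - linMin c X) / linWidth c X := hω
        rcases hw.eq_or_lt with h0 | h0
        · rw [← h0, div_zero] at hω'
          exact absurd ht0 hω'.not_ge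
        · exact (lt_div_iff₀ h0).1 hω'
    have hint : ∫ ω, Z ω ^ 2 ∂μ ≤ 2 / (n : ℝ) * beta ((N : ℝ) + 1) (2 / (n : ℝ)) := by
      rw [integral_eq_lintegral_of_nonneg_ae (Filter.Eventually.of_forall fun ω => sq_nonneg _)
        ((hmeas.div_const _).pow_const 2).aestronglyMeasurable]
      refine ENNReal.toReal_le_of_le_ofReal ?_ hlin
      have := beta_pos (show (0 : ℝ) < (N : ℝ) + 1 by positivity)
        (show (0 : ℝ) < 2 / (n : ℝ) by positivity)
      positivity
    rw [integral_congr_ae hYZ, integral_const_mul]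
    refine (mul_le_mul_of_nonneg_left hint (sq_nonneg _)).trans (le_of_eq ?_)
    ring
  · have ha1 : 2 / (n : ℝ) ≤ 1 := (div_le_one hn0).2 (by exact_mod_cast hn2)
    have h := mul_le_mul_of_nonneg_left (mul_beta_le_rpow (by positivity) ha1 N)
      (sq_nonneg (linWidth c X))
    refine le_trans (le_of_eq ?_) h
    ring
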